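/- Let $Y=2^{\omega_1\times\mathbb Z}$ with the product topology, and let $\eta:Y\to Y$ be the shift autohomeomorphism, $\eta(y)(\alpha,i)=y(\alpha,i+1)$. For a point $d\in Y$ let $d_m=\eta^m(d)$ ($m\in\omega$), and let $X=X_d$ be the following resolution of the Cantor set $2^\omega$, in which every point is replaced by $Y$. The underlying set of $X$ is $2^\omega\times Y$. For $x\in 2^\omega$ and $n\in\omega$ put $U_{x,n}=\{z\in 2^\omega: z\restriction n=x\restriction n\}$ and $C_{x,n}=U_{x,n}\setminus U_{x,n+1}$. The basic neighbourhoods of a point $(x,y)\in X$ are the sets $$U_{x,n}\otimes W=(\{x\}\times W)\cup\bigcup\{C_{x,m}\times Y: m\ge n,\ d_m\in W\},$$ where $n\in\omega$ and $W$ runs through the neighbourhoods of $y$ in $Y$. Then there is a point $d\in Y$ whose positive orbit $\{\eta^n(d):n\in\omega\}$ is dense in $Y$, and for every such $d$ the space $X=X_d$ is a zero-dimensional (that is, it has a base of clopen sets) compact Hausdorff space of $\pi$-weight $\pi(X)=\aleph_0$ and character $\chi(X)=\aleph_1$, such that 1. if Martin's Axiom and the negation of the Continuum Hypothesis hold, then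 $X$ is homogeneous (for all points $p,q\in X$ there is an autohomeomorphism of $X$ that maps $p$ to $q$); 2. if the Continuum Hypothesis holds, then $X$ is not homogeneous. -/

import Mathlib

open Set Topology

namespace VanMill

/-! ### Cardinal functions and homogeneity -/

/-- A `π`-base of `X`: a family of nonempty open sets such that every nonempty open set
includes a member of the family. -/
def IsPiBase {X : Type*} [TopologicalSpace X] (B : Set (Set X)) : Prop :=
  (∀ U ∈ B, IsOpen U ∧ U.Nonempty) ∧
    ∀ O : Set X, IsOpen O → O.Nonempty → ∃ U ∈ B, U ⊆ O

/-- The `π`-weight `π(X)`: the least cardinality of a `π`-base of `X`. -/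
noncomputable def piWeight (X : Type*) [TopologicalSpace X] : Cardinal :=
  sInf {κ | ∃ B : Set (Set X), IsPiBase B ∧ Cardinal.mk B = κ}

/-- A local base at `p`, consisting of open sets. -/
def IsLocalBase {X : Type*} [TopologicalSpace X] (p : X) (B : Set (Set X)) : Prop :=
  (∀ U ∈ B, IsOpen U ∧ p ∈ U) ∧
    ∀ O : Set X, IsOpen O → p ∈ O → ∃ U ∈ B, U ⊆ O

/-- The character `χ(p, X)` of the point `p`: the least cardinality of a local base at `p`. -/
noncomputable def characterAt {X : Type*} [TopologicalSpace X] (p : X) : Cardinal :=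
  sInf {κ | ∃ B : Set (Set X), IsLocalBase p B ∧ Cardinal.mk B = κ}

/-- The character `χ(X)`: the supremum of the characters of the points of `X`. -/
noncomputable def character (X : Type*) [TopologicalSpace X] : Cardinal :=
  ⨆ p : X, characterAt p

/-- `X` is zero-dimensional: its clopen sets form a base. -/
def IsZeroDimensional (X : Type*) [TopologicalSpace X] : Prop :=
  TopologicalSpace.IsTopologicalBasis {U : Set X | IsClopen U}

/-- `X` is homogeneous: for any points `p`, `q` some autohomeomorphism of `X` maps `p` to `q`. -/
def IsHomogeneous (X : Type*) [TopologicalSpace X] : Prop :=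
  ∀ p q : X, ∃ h : X ≃ₜ X, h p = q

/-! ### The Continuum Hypothesis and Martin's Axiom -/

/-- The Continuum Hypothesis, `2 ^ ℵ₀ = ℵ₁`. -/
def CH : Prop := Cardinal.continuum.{0} = Cardinal.aleph 1

/-- Two conditions of a forcing order are compatible if they have a common extension. -/
def Compatible {P : Type*} [Preorder P] (p q : P) : Prop := ∃ r, r ≤ p ∧ r ≤ q

/-- The countable chain condition: every set of pairwise incompatible conditions is countable. -/
def CCC (P : Type*) [Preorder P] : Prop :=
  ∀ A : Set P, A.Pairwise (fun p q => ¬ Compatible p q) → A.Countable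

/-- A set of conditions is dense if every condition has an extension in it. -/
def IsDenseSet {P : Type*} [Preorder P] (D : Set P) : Prop :=
  ∀ p, ∃ q ∈ D, q ≤ p

/-- Martin's Axiom: whenever `P` is a nonempty ccc order and `𝒟` is a family of fewer than
`2 ^ ℵ₀` dense subsets of `P`, there is a filter on `P` that meets every member of `𝒟`. -/
def MA : Prop :=
  ∀ (P : Type) [Preorder P] [Nonempty P], CCC P →
    ∀ 𝒟 : Set (Set P), Cardinal.mk 𝒟 < Cardinal.continuum → (∀ D ∈ 𝒟, IsDenseSet D) →
      ∃ G : Order.PFilter P, ∀ D ∈ 𝒟, ∃ p ∈ D, p ∈ G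

/-! ### The resolution of the Cantor set -/

section Construction

/-- The Cantor set `2 ^ ω`. -/
abbrev Cantor : Type := ℕ → Bool

/-- `U x n` is the set of all points of the Cantor set that agree with `x` in the first `n`
coordinates. -/
def U (x : Cantor) (n : ℕ) : Set Cantor := {z | ∀ i < n, z i = x i}

/-- `C x n = U x n \ U x (n + 1)`. -/
def C (x : Cantor) (n : ℕ) : Set Cantor := U x n \ U x (n + 1)

/-- The underlying set `2 ^ ω × Y` of the resolution of the Cantor set in which every point is
replaced by `Y`, by means of the autohomeomorphism `η` of `Y` and the point `d` of `Y`. It does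
not carry the product topology, but the topology defined below. -/
def Resolution {Y : Type*} [TopologicalSpace Y] (_η : Y ≃ₜ Y) (_d : Y) : Type _ := Cantor × Y

variable {Y : Type*} [TopologicalSpace Y] (η : Y ≃ₜ Y) (d : Y)

/-- The set `U x n ⊗ W`, the union of `{x} × W` and of all `C x m × Y` with `m ≥ n` and
`η ^ m (d) ∈ W`. -/
def tensor (x : Cantor) (n : ℕ) (W : Set Y) : Set (Resolution η d) :=
  {p | (p.1 = x ∧ p.2 ∈ W) ∨ ∃ m, n ≤ m ∧ η^[m] d ∈ W ∧ p.1 ∈ C x m}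

/-- The topology of the resolution: a set is open if with each of its points `(x, y)` it includes
some `U x n ⊗ W`, where `W` is a neighbourhood of `y`. -/
instance : TopologicalSpace (Resolution η d) where
  IsOpen O := ∀ p ∈ O, ∃ n, ∃ W ∈ 𝓝 p.2, tensor η d p.1 n W ⊆ O
  isOpen_univ := fun _ _ => ⟨0, univ, Filter.univ_mem, subset_univ _⟩
  isOpen_inter := by
    rintro O O' h h' p ⟨hp, hp'⟩
    obtain ⟨n, W, hW, hO⟩ := h p hp
    obtain ⟨n', W', hW', hO'⟩ := h' p hp'
    refine ⟨max n n', W ∩ W', Filter.inter_mem hW hW', fun q hq => ⟨hO ?_, hO' ?_⟩⟩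
    · rcases hq with ⟨h1, h2⟩ | ⟨m, h1, h2, h3⟩
      · exact Or.inl ⟨h1, h2.1⟩
      · exact Or.inr ⟨m, le_of_max_le_left h1, h2.1, h3⟩
    · rcases hq with ⟨h1, h2⟩ | ⟨m, h1, h2, h3⟩
      · exact Or.inl ⟨h1, h2.2⟩
      · exact Or.inr ⟨m, le_of_max_le_right h1, h2.2, h3⟩
  isOpen_sUnion := by
    rintro S h p ⟨O, hO, hp⟩
    obtain ⟨n, W, hW, hs⟩ := h O hO p hp
    exact ⟨n, W, hW, hs.trans (subset_sUnion_of_mem hO)⟩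

/-- If `W` is open, then `U x n ⊗ W` is open. -/
theorem isOpen_tensor (x : Cantor) (n : ℕ) {W : Set Y} (hW : IsOpen W) :
    IsOpen (tensor η d x n W) := by
  rintro ⟨z, y⟩ (⟨h1, h2⟩ | ⟨m, h1, h2, h3⟩)
  · have h1 : z = x := h1
    subst h1
    exact ⟨n, W, hW.mem_nhds h2, subset_rfl⟩
  · have h3 : z ∈ C x m := h3
    have key : U z (m + 1) ⊆ C x m := by
      intro w hw
      refine ⟨fun i hi => (hw i (by omega)).trans (h3.1 i hi), fun hw' => h3.2 fun i hi => ?_⟩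
      exact (hw i hi).symm.trans (hw' i hi)
    refine ⟨m + 1, univ, Filter.univ_mem, ?_⟩
    rintro ⟨w, v⟩ (⟨g1, -⟩ | ⟨k, g1, -, g3⟩)
    · have g1 : w = z := g1
      subst g1
      exact Or.inr ⟨m, h1, h2, h3⟩
    · have g3 : w ∈ C z k := g3
      exact Or.inr ⟨m, h1, h2, key fun i hi => g3.1 i (by omega)⟩

/-- The sets `U x n ⊗ W`, where `n` is a natural number and `W` runs through the neighbourhoods
of `y`, form a neighbourhood base at `(x, y)`. -/
theorem hasBasis_nhds (p : Resolution η d) :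
    (𝓝 p).HasBasis (fun i : ℕ × Set Y => i.2 ∈ 𝓝 p.2) (fun i => tensor η d p.1 i.1 i.2) := by
  refine ⟨fun N => ⟨fun hN => ?_, ?_⟩⟩
  · obtain ⟨O, hON, hO, hp⟩ := mem_nhds_iff.1 hN
    obtain ⟨n, W, hW, hs⟩ := hO p hp
    exact ⟨(n, W), hW, hs.trans hON⟩
  · rintro ⟨⟨n, W⟩, hW, hs⟩
    obtain ⟨V, hVW, hV, hy⟩ := mem_nhds_iff.1 hW
    refine mem_nhds_iff.2 ⟨tensor η d p.1 n V, fun q hq => hs ?_, isOpen_tensor η d p.1 n hV,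
      Or.inl ⟨rfl, hy⟩⟩
    rcases hq with ⟨h1, h2⟩ | ⟨m, h1, h2, h3⟩
    · exact Or.inl ⟨h1, hVW h2⟩
    · exact Or.inr ⟨m, h1, hVW h2, h3⟩

end Construction

/-! ### The space `2 ^ (ω₁ × ℤ)` and its shift -/

/-- The space `Y = 2 ^ (ω₁ × ℤ)`, with the product topology. -/
abbrev Y : Type := (Ordinal.omega.{0} 1).ToType × ℤ → Bool

/-- The shift `η` of `Y`, given by `η y (α, i) = y (α, i + 1)`. -/
def shift : Y ≃ₜ Y where
  toFun y a := y (a.1, a.2 + 1)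
  invFun y a := y (a.1, a.2 - 1)
  left_inv y := by funext a; simp
  right_inv y := by funext a; simp
  continuous_toFun := by fun_prop
  continuous_invFun := by fun_prop

/-- The space `X`: the resolution of the Cantor set in which every point is replaced by
`2 ^ (ω₁ × ℤ)`, by means of the shift and the point `d`. -/
abbrev X (d : Y) : Type := Resolution shift d

end VanMill

/-!
A point `(x, y)` of the resolution has as neighbourhoods the sets of points that are close to `x`
under the projection to the Cantor set and close to `y` under the retraction onto the fibre over
`x` that sends `C x m × Y` to `η ^ m (d)` (`nhds_eq`). So the topology is the one induced by the
projection and all these retractions. Compactness, the Hausdorff property and zero-dimensionality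
follow at once, and the character is that of the fibres, `ℵ₁`. Every nonempty open set includes
some `C x m × Y`, because the orbit of `d` is dense; hence the `π`-weight is `ℵ₀`.

Homogeneity: the clopen pieces `C x m × Y` and `C x' k × Y` are homeomorphic by a change of the
initial segment of the first coordinate and `η ^ (k - m)` on the second. To map `(x, y)` to
`(x', y')`, the fibre over `x` is translated by `a = y' - y` in the group `2 ^ (ω₁ × ℤ)`, and
`C x m × Y` is sent to `C x' (σ m) × Y` for a permutation `σ` of `ℕ`. The result is a homeomorphism
(`exists_homeomorph_of_tendsto`) as soon as `η ^ (σ m) (d) - η ^ m (d)` converges to `a`, that is, as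
soon as in each of the `ℵ₁` coordinates the difference is right for almost all `m`. A `σ` like that
is generic for finite partial injections with finite sets of coordinates as promises; this order is
a countable union of sets of pairwise compatible conditions, and Martin's Axiom applies to the
`ℵ₁ < 2 ^ ℵ₀` dense sets involved (`exists_perm_of_MA`).

Failure of homogeneity: an autohomeomorphism of a Hausdorff space with a countable `π`-base is
determined by a relation on that base, so a homogeneous such space has at most `2 ^ ℵ₀` points
(`mk_le_of_isHomogeneous`). The resolution has `2 ^ ℵ₁` points, which under the Continuum
Hypothesis is `2 ^ (2 ^ ℵ₀)`.
-/

namespace VanMill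

open Filter

/-! ### The retractions onto the fibres -/

theorem mem_C_iff {x z : Cantor} {m : ℕ} : z ∈ C x m ↔ z m ≠ x m ∧ ∀ i < m, z i = x i := by
  refine ⟨fun h => ⟨fun e => h.2 fun i hi => ?_, h.1⟩, fun h => ⟨h.2, fun h' => h.1 (h' m (by omega))⟩⟩
  rcases Nat.lt_succ_iff_lt_or_eq.1 hi with hi | rfl
  exacts [h.1 i hi, e]

theorem mem_C_iff_firstDiff {x z : Cantor} {m : ℕ} :
    z ∈ C x m ↔ z ≠ x ∧ PiNat.firstDiff x z = m := by
  constructor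
  · intro h
    rw [mem_C_iff] at h
    have hne : x ≠ z := fun e => h.1 (by rw [e])
    refine ⟨hne.symm, le_antisymm ?_ ?_⟩
    · by_contra! hlt
      exact h.1 (PiNat.apply_eq_of_lt_firstDiff hlt).symm
    · by_contra! hlt
      exact PiNat.apply_firstDiff_ne hne (h.2 _ hlt).symm
  · rintro ⟨hne, rfl⟩
    exact mem_C_iff.2 ⟨(PiNat.apply_firstDiff_ne hne.symm).symm,
      fun i hi => (PiNat.apply_eq_of_lt_firstDiff hi).symm⟩

theorem isOpen_U (x : Cantor) (n : ℕ) : IsOpen (U x n) := PiNat.isOpen_cylinder _ x n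

theorem hasBasis_nhds_cantor (x : Cantor) : (𝓝 x).HasBasis (fun _ => True) (U x) := by
  refine ⟨fun s => ⟨fun hs => ?_, fun ⟨n, _, hn⟩ => ?_⟩⟩
  · obtain ⟨_, ⟨y, n, rfl⟩, hx, hn⟩ :=
      (PiNat.isTopologicalBasis_cylinders fun _ : ℕ => Bool).mem_nhds_iff.1 hs
    rw [← PiNat.mem_cylinder_iff_eq.1 hx] at hn
    exact ⟨n, trivial, hn⟩
  · exact mem_of_superset ((isOpen_U x n).mem_nhds fun _ _ => rfl) hn

theorem C_mem_nhds {x z : Cantor} {m : ℕ} (h : z ∈ C x m) : C x m ∈ 𝓝 z := by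
  refine (hasBasis_nhds_cantor z).mem_iff.2 ⟨m + 1, trivial, fun w hw => ?_⟩
  rw [mem_C_iff] at h ⊢
  exact ⟨by rw [hw m (by omega)]; exact h.1, fun i hi => (hw i (by omega)).trans (h.2 i hi)⟩

theorem C_nonempty (x : Cantor) (m : ℕ) : (C x m).Nonempty :=
  ⟨fun i => if i = m then !x i else x i, mem_C_iff.2 ⟨by simp, fun i hi => by simp [hi.ne]⟩⟩

section Resolution

variable {Y : Type*} [TopologicalSpace Y] {η : Y ≃ₜ Y} {d : Y}

open Classical in
/-- The retraction of the resolution onto the fibre over `x`, which is identified with `Y`. It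
sends all of `C x m × Y` to `η ^ m (d)`. -/
noncomputable def retraction (x : Cantor) (p : Resolution η d) : Y :=
  if p.1 = x then p.2 else η^[PiNat.firstDiff x p.1] d

/-- The point `(x, y)` of the resolution. -/
def pt (x : Cantor) (y : Y) : Resolution η d := (x, y)

theorem retraction_of_eq {x : Cantor} {p : Resolution η d} (h : p.1 = x) :
    retraction x p = p.2 := if_pos h

theorem retraction_of_mem_C {x : Cantor} {m : ℕ} {p : Resolution η d} (h : p.1 ∈ C x m) :
    retraction x p = η^[m] d := by
  obtain ⟨h1, h2⟩ := mem_C_iff_firstDiff.1 h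
  rw [retraction, if_neg h1, h2]

theorem retraction_pt_self (x : Cantor) (y : Y) :
    retraction x (pt x y : Resolution η d) = y := retraction_of_eq rfl

theorem retraction_pt_of_mem_C {x z : Cantor} {m : ℕ} (h : z ∈ C x m) (y : Y) :
    retraction x (pt z y : Resolution η d) = η^[m] d := retraction_of_mem_C h

theorem eq_or_mem_C (x z : Cantor) : z = x ∨ ∃ m, z ∈ C x m :=
  or_iff_not_imp_left.2 fun h => ⟨_, mem_C_iff_firstDiff.2 ⟨h, rfl⟩⟩

theorem le_of_mem_C_of_mem_U {x z : Cantor} {m n : ℕ} (h : z ∈ C x m) (h' : z ∈ U x n) :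
    n ≤ m := by
  by_contra! hlt
  exact (mem_C_iff.1 h).1 (h' m hlt)

theorem mem_tensor_iff {x : Cantor} {n : ℕ} {W : Set Y} {p : Resolution η d} :
    p ∈ tensor η d x n W ↔ p.1 ∈ U x n ∧ retraction x p ∈ W := by
  constructor
  · rintro (⟨h1, h2⟩ | ⟨m, h1, h2, h3⟩)
    · exact ⟨fun i _ => by rw [h1], by rwa [retraction_of_eq h1]⟩
    · exact ⟨fun i hi => (mem_C_iff.1 h3).2 i (by omega), by rwa [retraction_of_mem_C h3]⟩
  · rintro ⟨h1, h2⟩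
    rcases eq_or_mem_C x p.1 with h | ⟨m, h⟩
    · exact Or.inl ⟨h, by rwa [retraction_of_eq h] at h2⟩
    · exact Or.inr ⟨m, le_of_mem_C_of_mem_U h h1, by rwa [retraction_of_mem_C h] at h2, h⟩

/-- The topology of the resolution is generated by the projection and the retractions onto the
fibres; near a point of the fibre over `x`, the retraction onto this fibre suffices. -/
theorem nhds_eq (p : Resolution η d) :
    𝓝 p = comap (fun q : Resolution η d => q.1) (𝓝 p.1) ⊓ comap (retraction p.1) (𝓝 p.2) := by
  refine (hasBasis_nhds η d p).eq_of_same_basis ?_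
  have := ((hasBasis_nhds_cantor p.1).comap (fun q : Resolution η d => q.1)).inf
    ((𝓝 p.2).basis_sets.comap (retraction (η := η) (d := d) p.1))
  simp only [true_and, id] at this
  refine this.congr (fun _ => Iff.rfl) fun i _ => ?_
  ext q
  exact mem_tensor_iff.symm

theorem continuous_proj : Continuous fun q : Resolution η d => q.1 :=
  continuous_iff_continuousAt.2 fun p => by
    rw [ContinuousAt, nhds_eq]
    exact tendsto_comap.mono_left inf_le_left

theorem continuous_retraction (x : Cantor) :
    Continuous (retraction x : Resolution η d → Y) := by
  refine continuous_def.2 fun W hW => ?_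
  convert isOpen_tensor η d x 0 hW
  ext p
  rw [mem_tensor_iff]
  exact ⟨fun h => ⟨fun _ h => absurd h (Nat.not_lt_zero _), h⟩, And.right⟩

theorem tendsto_nhds_resolution {α : Type*} {l : Filter α} {f : α → Resolution η d}
    {p : Resolution η d} (h1 : Tendsto (fun a => (f a).1) l (𝓝 p.1))
    (h2 : Tendsto (fun a => retraction p.1 (f a)) l (𝓝 p.2)) : Tendsto f l (𝓝 p) := by
  rw [nhds_eq]
  exact tendsto_inf.2 ⟨tendsto_comap_iff.2 h1, tendsto_comap_iff.2 h2⟩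

/-! ### Compactness and the separation properties -/

theorem compactSpace_resolution [CompactSpace Y] : CompactSpace (Resolution η d) := by
  refine ⟨isCompact_iff_ultrafilter_le_nhds.2 fun F _ => ?_⟩
  obtain ⟨x, -, hx⟩ := isCompact_univ.ultrafilter_le_nhds (F.map fun q : Resolution η d => q.1)
    (by simp)
  obtain ⟨y, -, hy⟩ := isCompact_univ.ultrafilter_le_nhds
    (F.map (retraction x : Resolution η d → Y)) (by simp)
  exact ⟨(x, y), mem_univ _, tendsto_nhds_resolution (f := id) (p := (x, y)) hx hy⟩

theorem t2Space_resolution [T2Space Y] : T2Space (Resolution η d) := by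
  refine ⟨fun p q hpq => ?_⟩
  by_cases h : p.1 = q.1
  · refine separated_by_continuous (continuous_retraction p.1) ?_
    rw [retraction_of_eq rfl, retraction_of_eq h.symm]
    exact fun e => hpq (Prod.ext h e)
  · exact separated_by_continuous continuous_proj h

theorem isZeroDimensional_resolution (hY : IsZeroDimensional Y) :
    IsZeroDimensional (Resolution η d) := by
  refine TopologicalSpace.isTopologicalBasis_of_isOpen_of_nhds (fun V hV => hV.isOpen) ?_
  intro p O hp hO
  obtain ⟨⟨n, W⟩, hW, hs⟩ := (hasBasis_nhds η d p).mem_iff.1 (hO.mem_nhds hp)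
  obtain ⟨V, hV, hpV, hVW⟩ := hY.mem_nhds_iff.1 hW
  obtain ⟨N, hN, hpN, hNU⟩ :=
    (isTopologicalBasis_isClopen (X := Cantor)).mem_nhds_iff.1
      ((isOpen_U p.1 n).mem_nhds fun _ _ => rfl)
  refine ⟨_, (hN.preimage continuous_proj).inter (hV.preimage (continuous_retraction p.1)),
    ⟨hpN, ?_⟩, fun q hq => hs (mem_tensor_iff.2 ⟨hNU hq.1, hVW hq.2⟩)⟩
  simpa [retraction_of_eq] using hpV

/-! ### The `π`-weight -/

theorem dense_tail (hd : Dense (range fun n : ℕ => η^[n] d)) {W : Set Y} (hW : IsOpen W)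
    (hne : W.Nonempty) (n : ℕ) : ∃ m ≥ n, η^[m] d ∈ W := by
  have hc : Continuous η^[n] := η.continuous.iterate n
  obtain ⟨w, hw⟩ := hne
  obtain ⟨v, rfl⟩ := η.surjective.iterate n w
  obtain ⟨_, hm, m, rfl⟩ := hd.inter_open_nonempty _ (hW.preimage hc) ⟨v, hw⟩
  refine ⟨n + m, by omega, ?_⟩
  rw [Function.iterate_add_apply]
  exact hm

theorem infinite_resolution [Nonempty Y] : Infinite (Resolution η d) :=
  inferInstanceAs (Infinite (Cantor × Y))

theorem aleph0_le_piWeight {X : Type*} [TopologicalSpace X] [T1Space X] [Infinite X]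
    (hne : ∃ B : Set (Set X), IsPiBase B) : Cardinal.aleph0 ≤ piWeight X := by
  obtain ⟨B₀, hB₀⟩ := hne
  refine le_csInf ⟨_, B₀, hB₀, rfl⟩ ?_
  rintro _ ⟨B, hB, rfl⟩
  by_contra! hlt
  have hfin : B.Finite := Cardinal.lt_aleph0_iff_set_finite.1 hlt
  choose! f hf using fun V hV => (hB.1 V hV).2
  have hF : (f '' B).Finite := hfin.image f
  obtain ⟨V, hV, hVF⟩ := hB.2 _ hF.isClosed.isOpen_compl hF.infinite_compl.nonempty
  exact hVF (hf V hV) (mem_image_of_mem f hV)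

/-- The preimages under the projection of the members of a countable base of the Cantor set form
a `π`-base: a nonempty open set includes some `U x n ⊗ W`, and hence `C x m × Y` for an `m` with
`η ^ m (d) ∈ W`. -/
theorem exists_countable_piBase [Nonempty Y] (hd : Dense (range fun n : ℕ => η^[n] d)) :
    ∃ B : Set (Set (Resolution η d)), B.Countable ∧ IsPiBase B := by
  obtain ⟨b, hbc, hbe, hb⟩ := TopologicalSpace.exists_countable_basis Cantor
  refine ⟨(fun V => (fun q : Resolution η d => q.1) ⁻¹' V) '' b, hbc.image _, ?_, ?_⟩
  · rintro _ ⟨V, hV, rfl⟩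
    refine ⟨(hb.isOpen hV).preimage continuous_proj, ?_⟩
    obtain ⟨z, hz⟩ : V.Nonempty := nonempty_iff_ne_empty.2 fun e => hbe (e ▸ hV)
    exact ⟨(z, Classical.arbitrary Y), hz⟩
  · rintro O hO ⟨p, hp⟩
    obtain ⟨⟨n, W⟩, hW, hs⟩ := (hasBasis_nhds η d p).mem_iff.1 (hO.mem_nhds hp)
    obtain ⟨W', hW', hWo, hpW⟩ := mem_nhds_iff.1 hW
    obtain ⟨m, hm, hmW⟩ := dense_tail hd hWo ⟨_, hpW⟩ n
    obtain ⟨z, hz⟩ := C_nonempty p.1 m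
    obtain ⟨V, hV, -, hVC⟩ := hb.mem_nhds_iff.1 (C_mem_nhds hz)
    exact ⟨_, mem_image_of_mem _ hV, fun q hq => hs (Or.inr ⟨m, hm, hW' hmW, hVC hq⟩)⟩

theorem piWeight_resolution [T2Space Y] [Nonempty Y]
    (hd : Dense (range fun n : ℕ => η^[n] d)) :
    piWeight (Resolution η d) = Cardinal.aleph0 := by
  obtain ⟨B, hBc, hB⟩ := exists_countable_piBase hd
  have := t2Space_resolution (η := η) (d := d)
  have := infinite_resolution (η := η) (d := d)
  refine le_antisymm ?_ (aleph0_le_piWeight ⟨B, hB⟩)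
  have hle : piWeight (Resolution η d) ≤ Cardinal.mk B := csInf_le' ⟨B, hB, rfl⟩
  exact hle.trans (Cardinal.le_aleph0_iff_set_countable.2 hBc)

/-! ### Gluing homeomorphisms of the resolution -/

/-- The map that carries `C x m` onto `C x' k`, for every `x`: the values from `m + 1` on are
kept, and follow the sequence that leaves `x'` at `k`. -/
def transfer (x' : Cantor) (m k : ℕ) (z : Cantor) : Cantor :=
  fun i => if i < k then x' i else if i = k then !x' k else z (i - k + m)

theorem transfer_mem_C (x' : Cantor) (m k : ℕ) (z : Cantor) : transfer x' m k z ∈ C x' k :=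
  mem_C_iff.2 ⟨by simp [transfer], fun i hi => by simp [transfer, hi]⟩

theorem transfer_transfer {x z : Cantor} {m : ℕ} (x' : Cantor) (k : ℕ) (hz : z ∈ C x m) :
    transfer x k m (transfer x' m k z) = z := by
  rw [mem_C_iff] at hz
  funext i
  simp only [transfer]
  split_ifs with h1 h2 h3 h4
  · exact (hz.2 i h1).symm
  · subst h2
    have := hz.1
    revert this
    cases z i <;> cases x i <;> simp
  · omega
  · omega
  · congr 1
    omega

theorem continuous_transfer (x' : Cantor) (m k : ℕ) : Continuous (transfer x' m k) := by
  refine continuous_pi fun i => ?_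
  simp only [transfer]
  split_ifs <;> fun_prop

theorem transfer_mem_C_transfer {x z w : Cantor} {m j : ℕ} (x' : Cantor) (k : ℕ)
    (hz : z ∈ C x m) (hw : w ∈ C x m) (hj : w ∈ C z j) :
    m < j ∧ transfer x' m k w ∈ C (transfer x' m k z) (j - m + k) := by
  rw [mem_C_iff] at hz hw hj
  have hmj : m < j := by
    by_contra! hle
    rcases hle.lt_or_eq with h | rfl
    · exact hj.1 ((hw.2 j h).trans (hz.2 j h).symm)
    · have h1 := hj.1
      have h2 := hz.1
      have h3 := hw.1
      revert h1 h2 h3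
      cases z j <;> cases w j <;> cases x j <;> simp
  refine ⟨hmj, mem_C_iff.2 ⟨?_, fun i hi => ?_⟩⟩
  · have h1 : ¬ j - m + k < k := by omega
    have h2 : ¬ j - m + k = k := by omega
    have h3 : j - m + k - k + m = j := by omega
    simpa only [transfer, h1, h2, h3, if_false] using hj.1
  · simp only [transfer]
    split_ifs
    · rfl
    · rfl
    · exact hj.2 _ (by omega)

theorem iterate_eq_zpow (n : ℕ) (v : Y) : η^[n] v = (η ^ (n : ℤ)) v := by
  induction n with
  | zero => rfl
  | succ n ih =>
    rw [Function.iterate_succ_apply', ih, Nat.cast_succ, add_comm, zpow_add, zpow_one]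
    rfl

open Classical in
/-- The map of the resolution to itself that sends the fibre over `x` to the fibre over `x'` by
means of `g`, and `C x m × Y` to `C x' (σ m) × Y` by means of `transfer` and a power of `η`. -/
noncomputable def glue (x x' : Cantor) (g : Y ≃ₜ Y) (σ : Equiv.Perm ℕ) (p : Resolution η d) :
    Resolution η d :=
  if p.1 = x then pt x' (g p.2) else
    pt (transfer x' (PiNat.firstDiff x p.1) (σ (PiNat.firstDiff x p.1)) p.1)
      ((η ^ ((σ (PiNat.firstDiff x p.1) : ℤ) - (PiNat.firstDiff x p.1 : ℤ))) p.2)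

theorem glue_of_eq {x x' : Cantor} {g : Y ≃ₜ Y} {σ : Equiv.Perm ℕ} {p : Resolution η d}
    (h : p.1 = x) : glue x x' g σ p = pt x' (g p.2) := if_pos h

theorem glue_pt_self (x x' : Cantor) (g : Y ≃ₜ Y) (σ : Equiv.Perm ℕ) (y : Y) :
    glue x x' g σ (pt x y : Resolution η d) = pt x' (g y) := glue_of_eq rfl

theorem glue_of_mem_C {x x' : Cantor} {g : Y ≃ₜ Y} {σ : Equiv.Perm ℕ} {p : Resolution η d}
    {m : ℕ} (h : p.1 ∈ C x m) :
    glue x x' g σ p = pt (transfer x' m (σ m) p.1) ((η ^ ((σ m : ℤ) - (m : ℤ))) p.2) := by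
  obtain ⟨h1, h2⟩ := mem_C_iff_firstDiff.1 h
  subst h2
  exact if_neg h1

theorem glue_glue (x x' : Cantor) (g : Y ≃ₜ Y) (σ : Equiv.Perm ℕ) (p : Resolution η d) :
    glue x' x g.symm σ.symm (glue x x' g σ p) = p := by
  rcases eq_or_mem_C x p.1 with h | ⟨m, h⟩
  · rw [glue_of_eq h, glue_pt_self]
    exact Prod.ext h.symm (g.symm_apply_apply _)
  · have h' : (glue x x' g σ p).1 ∈ C x' (σ m) := by
      rw [glue_of_mem_C h]
      exact transfer_mem_C x' m (σ m) p.1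
    rw [glue_of_mem_C h', glue_of_mem_C h, σ.symm_apply_apply]
    refine Prod.ext (transfer_transfer x' (σ m) h) ?_
    change (η ^ ((m : ℤ) - (σ m : ℤ)) * η ^ ((σ m : ℤ) - (m : ℤ))) p.2 = p.2
    rw [← zpow_add]
    simp

/-- The pieces of `glue` fit together if `g`, with `σ` on the indices, is continuous on the
compactification of `ℕ` with remainder `Y` in which `m` is close to `η ^ m (d)`. -/
theorem continuous_glue (x x' : Cantor) {g : Y ≃ₜ Y} {σ : Equiv.Perm ℕ}
    (H : ∀ y, Tendsto (fun m => η^[σ m] d) (atTop ⊓ comap (fun m => η^[m] d) (𝓝 y)) (𝓝 (g y))) :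
    Continuous (glue x x' g σ : Resolution η d → Resolution η d) := by
  refine continuous_iff_continuousAt.2 fun p => ?_
  rcases eq_or_mem_C x p.1 with h | ⟨m, h⟩
  · refine tendsto_nhds_resolution ?_ ?_
    · rw [glue_of_eq h]
      refine (hasBasis_nhds_cantor x').tendsto_right_iff.2 fun N _ => ?_
      have hσ : Tendsto σ atTop atTop := by
        simpa [Nat.cofinite_eq_atTop] using σ.injective.tendsto_cofinite
      obtain ⟨n, hn⟩ := eventually_atTop.1 (hσ.eventually_ge_atTop N)
      have hU : ∀ᶠ q : Resolution η d in 𝓝 p, q.1 ∈ U x n :=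
        continuous_proj.continuousAt ((isOpen_U x n).mem_nhds (by rw [h]; exact fun _ _ => rfl))
      filter_upwards [hU] with q hq
      rcases eq_or_mem_C x q.1 with h' | ⟨k, h'⟩
      · rw [glue_of_eq h']
        exact fun _ _ => rfl
      · rw [glue_of_mem_C h']
        have hk := hn k (le_of_mem_C_of_mem_U h' hq)
        exact fun i hi => (transfer_mem_C x' k (σ k) q.1).1 i (by omega)
    · rw [glue_of_eq h]
      intro W hW
      have hW1 : g ⁻¹' W ∈ 𝓝 p.2 := g.continuous.continuousAt hW
      obtain ⟨⟨n, W'⟩, ⟨-, hW2⟩, hs⟩ :=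
        (atTop_basis.inf ((𝓝 p.2).basis_sets.comap fun m => η^[m] d)).mem_iff.1 (H p.2 hW)
      refine (hasBasis_nhds η d p).mem_iff.2 ⟨(n, W' ∩ g ⁻¹' W), inter_mem hW2 hW1, ?_⟩
      rintro q (⟨h1, h2⟩ | ⟨k, h1, h2, h3⟩)
      · have h4 : q.1 = x := h1.trans h
        change retraction x' (glue x x' g σ q) ∈ W
        rw [glue_of_eq h4, retraction_pt_self]
        exact h2.2
      · rw [h] at h3
        change retraction x' (glue x x' g σ q) ∈ W
        rw [glue_of_mem_C h3, retraction_pt_of_mem_C (transfer_mem_C x' k (σ k) q.1)]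
        exact hs ⟨h1, h2.1⟩
  · have hev : ∀ᶠ q : Resolution η d in 𝓝 p, q.1 ∈ C x m :=
      continuous_proj.continuousAt (C_mem_nhds h)
    refine tendsto_nhds_resolution ?_ ?_
    · rw [glue_of_mem_C h]
      refine Tendsto.congr' ?_
        (((continuous_transfer x' m (σ m)).comp continuous_proj).tendsto p)
      filter_upwards [hev] with q hq
      rw [glue_of_mem_C hq]
      rfl
    · rw [glue_of_mem_C h]
      have hc : Tendsto (fun q : Resolution η d => (η ^ ((σ m : ℤ) - (m : ℤ))) (retraction p.1 q))
          (𝓝 p) (𝓝 ((η ^ ((σ m : ℤ) - (m : ℤ))) (retraction p.1 p))) :=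
        ((η ^ ((σ m : ℤ) - (m : ℤ))).continuous.comp (continuous_retraction p.1)).tendsto p
      rw [retraction_of_eq rfl] at hc
      refine Tendsto.congr' ?_ hc
      filter_upwards [hev] with q hq
      rw [glue_of_mem_C hq]
      rcases eq_or_mem_C p.1 q.1 with h' | ⟨j, h'⟩
      · rw [retraction_of_eq h', h']
        exact (retraction_pt_self _ _).symm
      · obtain ⟨hmj, hj⟩ := transfer_mem_C_transfer x' (σ m) h hq h'
        rw [retraction_of_mem_C h']
        refine Eq.trans ?_ (retraction_pt_of_mem_C hj _).symm
        rw [iterate_eq_zpow, iterate_eq_zpow, ← Homeomorph.mul_apply, ← zpow_add]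
        congr 2
        omega

theorem exists_homeomorph_of_tendsto {g : Y ≃ₜ Y} {σ : Equiv.Perm ℕ}
    (H : ∀ y, Tendsto (fun m => η^[σ m] d) (atTop ⊓ comap (fun m => η^[m] d) (𝓝 y)) (𝓝 (g y)))
    (H' : ∀ y, Tendsto (fun m => η^[σ.symm m] d) (atTop ⊓ comap (fun m => η^[m] d) (𝓝 y))
      (𝓝 (g.symm y)))
    (x x' : Cantor) (y : Y) :
    ∃ h : Resolution η d ≃ₜ Resolution η d, h (pt x y) = pt x' (g y) :=
  ⟨{  toFun := glue x x' g σ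
      invFun := glue x' x g.symm σ.symm
      left_inv := glue_glue x x' g σ
      right_inv := glue_glue x' x g.symm σ.symm
      continuous_toFun := continuous_glue x x' H
      continuous_invFun := continuous_glue x' x H' }, glue_of_eq rfl⟩

end Resolution

/-! ### A permutation from Martin's Axiom -/

/-- The forcing conditions that add a permutation `σ` of `ℕ` with `R c m (σ m)` for each `c` and
almost all `m`: a finite injective partial map, given by its graph, together with a finite set of
indices `c` for which the condition `R c` has to be respected from then on. -/
structure PermCondition {I : Type} (R : I → ℕ → ℕ → Prop) : Type where
  graph : Finset (ℕ × ℕ)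
  side : Finset I
  fst_inj : ∀ e ∈ graph, ∀ e' ∈ graph, e.1 = e'.1 → e = e'
  snd_inj : ∀ e ∈ graph, ∀ e' ∈ graph, e.2 = e'.2 → e = e'

namespace PermCondition

variable {I : Type} {R : I → ℕ → ℕ → Prop}

instance : Preorder (PermCondition R) where
  le p q := q.graph ⊆ p.graph ∧ q.side ⊆ p.side ∧
    ∀ e ∈ p.graph, e ∉ q.graph → ∀ c ∈ q.side, R c e.1 e.2
  le_refl p := ⟨subset_rfl, subset_rfl, fun _ h h' => absurd h h'⟩
  le_trans p q r hpq hqr := by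
    refine ⟨hqr.1.trans hpq.1, hqr.2.1.trans hpq.2.1, fun e he he' c hc => ?_⟩
    by_cases h : e ∈ q.graph
    · exact hqr.2.2 e h he' c hc
    · exact hpq.2.2 e he h c (hqr.2.1 hc)

instance : Nonempty (PermCondition R) := ⟨⟨∅, ∅, by simp, by simp⟩⟩

/-- Conditions with the same graph are compatible, and there are only countably many graphs. -/
theorem ccc : CCC (PermCondition R) := by
  classical
  intro A hA
  have hinj : InjOn PermCondition.graph A := by
    intro p hp q hq hpq
    by_contra hne
    refine hA hp hq hne ⟨⟨p.graph, p.side ∪ q.side, p.fst_inj, p.snd_inj⟩, ?_, ?_⟩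
    · exact ⟨subset_rfl, Finset.subset_union_left, fun _ h h' => absurd h h'⟩
    · exact ⟨hpq.symm.subset, Finset.subset_union_right, fun _ h h' => absurd (hpq ▸ h) h'⟩
  exact MapsTo.countable_of_injOn (mapsTo_image _ _) hinj (to_countable _)

theorem exists_le_insert (p : PermCondition R) {m k : ℕ} (hm : ∀ e ∈ p.graph, e.1 ≠ m)
    (hk : ∀ e ∈ p.graph, e.2 ≠ k) (hR : ∀ c ∈ p.side, R c m k) :
    ∃ q ≤ p, (m, k) ∈ q.graph := by
  refine ⟨⟨insert (m, k) p.graph, p.side, ?_, ?_⟩, ⟨Finset.subset_insert _ _, subset_rfl, ?_⟩,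
    Finset.mem_insert_self _ _⟩
  · intro e he e' he' h
    rcases Finset.mem_insert.1 he with rfl | he <;> rcases Finset.mem_insert.1 he' with rfl | he'
    · rfl
    · exact absurd h.symm (hm _ he')
    · exact absurd h (hm _ he)
    · exact p.fst_inj e he e' he' h
  · intro e he e' he' h
    rcases Finset.mem_insert.1 he with rfl | he <;> rcases Finset.mem_insert.1 he' with rfl | he'
    · rfl
    · exact absurd h.symm (hk _ he')
    · exact absurd h (hk _ he)
    · exact p.snd_inj e he e' he' h
  · intro e he he' c hc
    rcases Finset.mem_insert.1 he with rfl | he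
    · exact hR c hc
    · exact absurd he he'

end PermCondition

theorem exists_perm_of_MA (hMA : MA) {I : Type} (hI : Cardinal.mk I < Cardinal.continuum)
    (R : I → ℕ → ℕ → Prop)
    (hright : ∀ (F : Finset I) (m n : ℕ), ∃ k ≥ n, ∀ c ∈ F, R c m k)
    (hleft : ∀ (F : Finset I) (k n : ℕ), ∃ m ≥ n, ∀ c ∈ F, R c m k) :
    ∃ σ : Equiv.Perm ℕ, ∀ c, ∀ᶠ m in atTop, R c m (σ m) := by
  classical
  let D : ℕ ⊕ ℕ ⊕ I → Set (PermCondition R) := Sum.elim (fun m => {p | ∃ k, (m, k) ∈ p.graph})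
    (Sum.elim (fun k => {p | ∃ m, (m, k) ∈ p.graph}) fun c => {p | c ∈ p.side})
  have hcard : Cardinal.mk (range D) < Cardinal.continuum := by
    refine Cardinal.mk_range_le.trans_lt ?_
    simp only [Cardinal.mk_sum, Cardinal.mk_nat, Cardinal.lift_id]
    have h0 := Cardinal.aleph0_lt_continuum
    have hc := Cardinal.aleph0_le_continuum
    exact Cardinal.add_lt_of_lt hc h0 (Cardinal.add_lt_of_lt hc h0 hI)
  have hdense : ∀ E ∈ range D, IsDenseSet E := by
    rintro _ ⟨m | k | c, rfl⟩ p
    · by_cases hm : ∃ k, (m, k) ∈ p.graph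
      · exact ⟨p, hm, le_rfl⟩
      · obtain ⟨k, hk, hR⟩ := hright p.side m (p.graph.sup Prod.snd + 1)
        obtain ⟨q, hq, hmk⟩ := p.exists_le_insert (m := m) (k := k)
          (fun e he h => hm ⟨e.2, h ▸ he⟩)
          (fun e he h => by have := Finset.le_sup (f := Prod.snd) he; omega) hR
        exact ⟨q, ⟨k, hmk⟩, hq⟩
    · by_cases hk : ∃ m, (m, k) ∈ p.graph
      · exact ⟨p, hk, le_rfl⟩
      · obtain ⟨m, hm, hR⟩ := hleft p.side k (p.graph.sup Prod.fst + 1)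
        obtain ⟨q, hq, hmk⟩ := p.exists_le_insert (m := m) (k := k)
          (fun e he h => by have := Finset.le_sup (f := Prod.fst) he; omega)
          (fun e he h => hk ⟨e.1, h ▸ he⟩) hR
        exact ⟨q, ⟨m, hmk⟩, hq⟩
    · exact ⟨⟨p.graph, insert c p.side, p.fst_inj, p.snd_inj⟩, Finset.mem_insert_self _ _,
        subset_rfl, Finset.subset_insert _ _, fun _ h h' => absurd h h'⟩
  obtain ⟨G, hG⟩ := hMA (PermCondition R) PermCondition.ccc (range D) hcard hdense
  have hdom : ∀ m, ∃ k, ∃ p ∈ G, (m, k) ∈ p.graph := fun m => by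
    obtain ⟨p, ⟨k, hk⟩, hp⟩ := hG _ ⟨Sum.inl m, rfl⟩
    exact ⟨k, p, hp, hk⟩
  have hran : ∀ k, ∃ m, ∃ p ∈ G, (m, k) ∈ p.graph := fun k => by
    obtain ⟨p, ⟨m, hm⟩, hp⟩ := hG _ ⟨Sum.inr (Sum.inl k), rfl⟩
    exact ⟨m, p, hp, hm⟩
  choose f hf using hdom
  have hfun : ∀ {m k}, (∃ p ∈ G, (m, k) ∈ p.graph) → f m = k := by
    rintro m k ⟨p, hp, hmk⟩
    obtain ⟨q, hq, hmf⟩ := hf m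
    obtain ⟨r, -, hrp, hrq⟩ := G.directed p hp q hq
    exact congrArg Prod.snd (r.fst_inj _ (hrq.1 hmf) _ (hrp.1 hmk) rfl)
  have hbij : Function.Bijective f := by
    constructor
    · intro m m' h
      obtain ⟨p, hp, hm⟩ := hf m
      obtain ⟨q, hq, hm'⟩ := hf m'
      obtain ⟨r, -, hrp, hrq⟩ := G.directed p hp q hq
      exact congrArg Prod.fst (r.snd_inj _ (hrp.1 hm) _ (hrq.1 hm') h)
    · intro k
      obtain ⟨m, hm⟩ := hran k
      exact ⟨m, hfun hm⟩
  refine ⟨Equiv.ofBijective f hbij, fun c => ?_⟩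
  obtain ⟨p, hpc, hp⟩ := hG _ ⟨Sum.inr (Sum.inr c), rfl⟩
  filter_upwards [eventually_gt_atTop (p.graph.sup Prod.fst)] with m hm
  obtain ⟨q, hq, hmf⟩ := hf m
  obtain ⟨r, -, hrp, hrq⟩ := G.directed p hp q hq
  refine hrp.2.2 _ (hrq.1 hmf) (fun h => ?_) c hpc
  have := Finset.le_sup (f := Prod.fst) h
  simp only at this
  omega

/-! ### Counting the points of a homogeneous space -/

/-- An autohomeomorphism `h` is determined by the relation `h '' V ∩ V' ≠ ∅` between the members
`V`, `V'` of a `π`-base. -/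
theorem mk_le_of_isHomogeneous {X : Type} [TopologicalSpace X] [T2Space X]
    (hX : IsHomogeneous X) {B : Set (Set X)} (hBc : B.Countable) (hB : IsPiBase B) :
    Cardinal.mk X ≤ Cardinal.continuum := by
  rcases isEmpty_or_nonempty X with _ | ⟨⟨p⟩⟩
  · simp
  choose h hh using hX p
  let Φ : X → Set (B × B) := fun q => {V | ∃ x ∈ V.1.1, h q x ∈ V.2.1}
  have hΦ : Function.Injective Φ := by
    intro q q' hq
    by_contra hne
    rw [← hh q, ← hh q'] at hne
    obtain ⟨O, O', hO, hO', hqO, hqO', hdis⟩ := t2_separation hne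
    obtain ⟨V, hV, hVO⟩ := hB.2 (h q ⁻¹' O ∩ h q' ⁻¹' O')
      ((hO.preimage (h q).continuous).inter (hO'.preimage (h q').continuous)) ⟨p, hqO, hqO'⟩
    obtain ⟨V', hV', hVV'⟩ := hB.2 (h q '' V) ((h q).isOpenMap _ (hB.1 V hV).1)
      ((hB.1 V hV).2.image _)
    obtain ⟨v, hv⟩ := (hB.1 V' hV').2
    obtain ⟨x, hx, rfl⟩ := hVV' hv
    have hmem : ((⟨V, hV⟩, ⟨V', hV'⟩) : B × B) ∈ Φ q := ⟨x, hx, hv⟩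
    rw [hq] at hmem
    obtain ⟨x', hx', hv'⟩ := hmem
    obtain ⟨x'', hx'', he⟩ := hVV' hv'
    refine hdis.le_bot ⟨(hVO hx'').1, ?_⟩
    rw [he]
    exact (hVO hx').2
  have := hBc.to_subtype
  refine (Cardinal.mk_le_of_injective hΦ).trans ?_
  rw [Cardinal.mk_set, ← Cardinal.two_power_aleph0]
  exact Cardinal.power_le_power_left two_ne_zero Cardinal.mk_le_aleph0

/-! ### A dense orbit of the shift -/

/-- There is a sequence over a countable alphabet that contains every finite word. -/
theorem exists_universal_sequence (A : Type*) [Countable A] [Nonempty A] :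
    ∃ u : ℕ → A, ∀ l : List A, ∃ n, ∀ i (hi : i < l.length), u (n + i) = l[i] := by
  obtain ⟨e, he⟩ := exists_surjective_nat (List A × ℕ)
  -- The word `(e j).1` is written into the interval from `j ^ 2` to `j ^ 2 + 2 * j`.
  refine ⟨fun m => (e m.sqrt).1.getD (m - m.sqrt * m.sqrt) (Classical.arbitrary A), fun l => ?_⟩
  obtain ⟨j, hj, hl⟩ : ∃ j ≥ l.length, (e j).1 = l := by
    have hinf : (range fun n : ℕ => ((l, n) : List A × ℕ)).Infinite :=
      infinite_range_of_injective fun a b h => congrArg Prod.snd h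
    obtain ⟨j, ⟨n, hn⟩, hj⟩ := (hinf.preimage (f := e) (by simp [he.range_eq])).exists_gt l.length
    exact ⟨j, hj.le, by rw [← hn]⟩
  refine ⟨j * j, fun i hi => ?_⟩
  have hs : (j * j + i).sqrt = j := Nat.sqrt_add_eq j (by omega)
  simp only [hs, hl, Nat.add_sub_cancel_left]
  simp [hi]

/-- Countably many functions on a set of at most `2 ^ ℵ₀` points suffice to realize every finite
pattern. -/
theorem exists_countable_patterns {I : Type} (hI : Cardinal.mk I ≤ Cardinal.continuum) :
    ∃ A : Set (I → Bool), A.Countable ∧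
      ∀ (F : Finset I) (t : I → Bool), ∃ a ∈ A, ∀ c ∈ F, a c = t c := by
  classical
  obtain ⟨r⟩ : Nonempty (I ↪ Cantor) := by
    rw [← Cardinal.le_def]
    simpa using hI
  -- `I` is viewed as a subset of the Cantor set; the functions read off an initial segment.
  refine ⟨range fun s : Finset (List Bool) => fun c =>
      decide (∃ k, PiNat.res (r c) k ∈ s), countable_range _, fun F t => ?_⟩
  obtain ⟨k, hk⟩ : ∃ k, ∀ c ∈ F, ∀ c' ∈ F, c ≠ c' →
      PiNat.firstDiff (r c) (r c') < k := by
    refine ⟨(F ×ˢ F).sup (fun e => PiNat.firstDiff (r e.1) (r e.2)) + 1, fun c hc c' hc' _ => ?_⟩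
    exact Nat.lt_succ_of_le (Finset.le_sup (f := fun e : I × I => PiNat.firstDiff (r e.1) (r e.2))
      (Finset.mk_mem_product hc hc'))
  refine ⟨_, ⟨(F.filter fun c => t c).image fun c => PiNat.res (r c) k, rfl⟩, fun c hc => ?_⟩
  rw [Bool.eq_iff_iff, decide_eq_true_iff]
  constructor
  · rintro ⟨j, hj⟩
    obtain ⟨c', hc', he⟩ := Finset.mem_image.1 hj
    rw [Finset.mem_filter] at hc'
    have hjk : k = j := by simpa using congrArg List.length he
    subst hjk
    by_contra hne
    have hcc : c' ≠ c := fun e => hne (e ▸ hc'.2)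
    exact PiNat.apply_firstDiff_ne (r.injective.ne hcc)
      (PiNat.res_eq_res.1 he (hk c' hc'.1 c hc hcc))
  · exact fun h => ⟨k, Finset.mem_image_of_mem _ (Finset.mem_filter.2 ⟨hc, h⟩)⟩

/-! ### The space `2 ^ (ω₁ × ℤ)` -/

theorem isOpen_pi_bool_eq {I : Type*} (y : I → Bool) (F : Finset I) :
    IsOpen {w : I → Bool | ∀ c ∈ F, w c = y c} := by
  have : {w : I → Bool | ∀ c ∈ F, w c = y c} = (F : Set I).pi fun c => {y c} := rfl
  rw [this]
  exact isOpen_set_pi F.finite_toSet fun _ _ => isOpen_discrete _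

theorem hasBasis_nhds_pi_bool {I : Type*} (y : I → Bool) :
    (𝓝 y).HasBasis (fun _ : Finset I => True) (fun F => {w | ∀ c ∈ F, w c = y c}) := by
  refine ⟨fun s => ⟨fun hs => ?_, fun ⟨F, _, hF⟩ => ?_⟩⟩
  · obtain ⟨O, hOs, hO, hy⟩ := mem_nhds_iff.1 hs
    obtain ⟨F, u, hu, hF⟩ := isOpen_pi_iff.1 hO y hy
    exact ⟨F, trivial, fun w hw => hOs (hF fun c hc => by rw [hw c hc]; exact (hu c hc).2)⟩
  · exact mem_of_superset ((isOpen_pi_bool_eq y F).mem_nhds fun _ _ => rfl) hF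

theorem mk_index : Cardinal.mk ((Ordinal.omega.{0} 1).ToType × ℤ) = Cardinal.aleph 1 := by
  rw [Cardinal.mk_prod, Cardinal.lift_id, Cardinal.lift_id, Cardinal.mk_toType,
    Ordinal.card_omega, Cardinal.mk_int]
  exact Cardinal.mul_eq_left (Cardinal.aleph0_le_aleph 1) (Cardinal.aleph0_le_aleph 1)
    Cardinal.aleph0_ne_zero

theorem infinite_index : Infinite ((Ordinal.omega.{0} 1).ToType × ℤ) := by
  rw [Cardinal.infinite_iff, mk_index]
  exact Cardinal.aleph0_le_aleph 1

theorem shift_iterate_apply (n : ℕ) (y : Y) (c : (Ordinal.omega.{0} 1).ToType × ℤ) :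
    shift^[n] y c = y (c.1, c.2 + n) := by
  induction n generalizing c with
  | zero => simp
  | succ n ih =>
    rw [Function.iterate_succ_apply']
    change shift^[n] y (c.1, c.2 + 1) = _
    rw [ih]
    congr 2
    push_cast
    ring

/-- A universal sequence of functions on `ω₁` that realize all finite patterns is, read
coordinatewise, a point with a dense orbit. -/
theorem exists_dense_orbit : ∃ d : Y, Dense (range fun n : ℕ => shift^[n] d) := by
  have hle : Cardinal.mk (Ordinal.omega.{0} 1).ToType ≤ Cardinal.continuum := by
    rw [Cardinal.mk_toType, Ordinal.card_omega]
    exact Cardinal.aleph_one_le_continuum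
  obtain ⟨A, hA, hpat⟩ := exists_countable_patterns hle
  have : Countable A := hA.to_subtype
  have : Nonempty A := by
    obtain ⟨a, ha, -⟩ := hpat ∅ fun _ => false
    exact ⟨a, ha⟩
  obtain ⟨u, hu⟩ := exists_universal_sequence A
  refine ⟨fun c => (u c.2.toNat).1 c.1, fun y => ?_⟩
  refine mem_closure_iff_nhds.2 fun W hW => ?_
  obtain ⟨F, -, hF⟩ := (hasBasis_nhds_pi_bool y).mem_iff.1 hW
  classical
  obtain ⟨N, hN⟩ : ∃ N : ℕ, ∀ c ∈ F, c.2.natAbs < N :=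
    ⟨F.sup (fun c => c.2.natAbs) + 1, fun c hc =>
      Nat.lt_succ_of_le (Finset.le_sup (f := fun c => c.2.natAbs) hc)⟩
  choose a ha hay using fun i : ℤ => hpat (F.image Prod.fst) fun α => y (α, i)
  -- The word describes `y` on the coordinates in the interval from `-N` to `N`.
  obtain ⟨n, hn⟩ := hu (List.ofFn fun i : Fin (2 * N + 1) => (⟨a (i - N), ha _⟩ : A))
  refine ⟨_, hF fun c hc => ?_, n + N, rfl⟩
  have hcN := hN c hc
  obtain ⟨j, hj⟩ : ∃ j : ℕ, c.2 + N = j := ⟨(c.2 + N).toNat, by omega⟩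
  have h1 := hn j (by simp; omega)
  simp only [List.getElem_ofFn] at h1
  have h2 : (c.2 + ((n + N : ℕ) : ℤ)).toNat = n + j := by omega
  have h3 : (j : ℤ) - N = c.2 := by omega
  refine (shift_iterate_apply (n + N) _ c).trans ?_
  simp only [h2, h1, h3]
  exact hay c.2 c.1 (Finset.mem_image_of_mem _ hc)

/-! ### The character -/

theorem characterAt_le (d : Y) (p : X d) : characterAt p ≤ Cardinal.aleph 1 := by
  have := infinite_index
  let b : ℕ × Finset ((Ordinal.omega.{0} 1).ToType × ℤ) → Set (X d) :=
    fun i => tensor shift d p.1 i.1 {w | ∀ c ∈ i.2, w c = p.2 c}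
  have hb : IsLocalBase p (range b) := by
    constructor
    · rintro _ ⟨i, rfl⟩
      exact ⟨isOpen_tensor _ _ _ _ (isOpen_pi_bool_eq _ _), Or.inl ⟨rfl, fun _ _ => rfl⟩⟩
    · intro O hO hp
      obtain ⟨⟨n, W⟩, hW, hs⟩ := (hasBasis_nhds shift d p).mem_iff.1 (hO.mem_nhds hp)
      obtain ⟨F, -, hF⟩ := (hasBasis_nhds_pi_bool p.2).mem_iff.1 hW
      refine ⟨_, ⟨(n, F), rfl⟩, fun q hq => hs ?_⟩
      rw [mem_tensor_iff] at hq ⊢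
      exact ⟨hq.1, hF hq.2⟩
  have hle : characterAt p ≤ Cardinal.mk (range b) := csInf_le' ⟨_, hb, rfl⟩
  refine hle.trans (Cardinal.mk_range_le.trans ?_)
  rw [Cardinal.mk_prod, Cardinal.lift_id, Cardinal.lift_id, Cardinal.mk_finset_of_infinite,
    mk_index, Cardinal.mk_nat]
  exact (Cardinal.mul_eq_right (Cardinal.aleph0_le_aleph 1) (Cardinal.aleph0_le_aleph 1)
    Cardinal.aleph0_ne_zero).le

/-- Countably many neighbourhoods of a point restrict only countably many coordinates on its
fibre. -/
theorem le_characterAt (d : Y) (p : X d) : Cardinal.aleph 1 ≤ characterAt p := by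
  refine le_csInf ⟨_, {O | IsOpen O ∧ p ∈ O},
    ⟨fun _ h => h, fun O h h' => ⟨O, ⟨h, h'⟩, subset_rfl⟩⟩, rfl⟩ ?_
  rintro _ ⟨B, hB, rfl⟩
  by_contra! hlt
  have hBc : B.Countable :=
    Cardinal.le_aleph0_iff_set_countable.1 (Cardinal.lt_aleph_one_iff.1 hlt)
  have hF : ∀ O ∈ B, ∃ F : Finset ((Ordinal.omega.{0} 1).ToType × ℤ),
      ∀ w : Y, (∀ c ∈ F, w c = p.2 c) → (pt p.1 w : X d) ∈ O := by
    intro O hO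
    obtain ⟨⟨n, W⟩, hW, hs⟩ :=
      (hasBasis_nhds shift d p).mem_iff.1 ((hB.1 O hO).1.mem_nhds (hB.1 O hO).2)
    obtain ⟨F, -, hF⟩ := (hasBasis_nhds_pi_bool p.2).mem_iff.1 hW
    exact ⟨F, fun w hw => hs (Or.inl ⟨rfl, hF hw⟩)⟩
  choose! F hF using hF
  have hcount : (⋃ O ∈ B, (F O : Set ((Ordinal.omega.{0} 1).ToType × ℤ))).Countable :=
    hBc.biUnion fun O _ => (F O).countable_toSet
  obtain ⟨c, hc⟩ : ∃ c, c ∉ ⋃ O ∈ B, (F O : Set ((Ordinal.omega.{0} 1).ToType × ℤ)) := by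
    by_contra! hall
    rw [eq_univ_of_forall hall, countable_univ_iff, ← Cardinal.mk_le_aleph0_iff, mk_index] at hcount
    exact hcount.not_gt Cardinal.aleph0_lt_aleph_one
  obtain ⟨O, hO, hs⟩ := hB.2 (tensor shift d p.1 0 {w | ∀ c' ∈ ({c} : Finset _), w c' = p.2 c'})
    (isOpen_tensor _ _ _ _ (isOpen_pi_bool_eq _ _)) (Or.inl ⟨rfl, fun _ _ => rfl⟩)
  classical
  have hmem : (pt p.1 (Function.update p.2 c (!p.2 c)) : X d) ∈ O := by
    refine hF O hO _ fun c' hc' => ?_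
    have hne : c' ≠ c := by
      rintro rfl
      exact hc (mem_biUnion hO hc')
    simp [hne]
  have h := (mem_tensor_iff.1 (hs hmem)).2
  rw [retraction_pt_self] at h
  simpa using h c (Finset.mem_singleton_self c)

theorem character_eq (d : Y) : character (X d) = Cardinal.aleph 1 := by
  refine le_antisymm (ciSup_le' (characterAt_le d)) ?_
  refine (le_characterAt d (pt (fun _ => false) d)).trans (le_ciSup ?_ _)
  exact ⟨_, forall_mem_range.2 (characterAt_le d)⟩

/-! ### Homogeneity -/

/-- The translation of `Y` by `a`, with respect to addition modulo `2` in each coordinate. -/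
def translation {I : Type*} (a : I → Bool) : (I → Bool) ≃ₜ (I → Bool) where
  toFun w c := xor (w c) (a c)
  invFun w c := xor (w c) (a c)
  left_inv w := by simp
  right_inv w := by simp
  continuous_toFun := continuous_pi fun c =>
    (continuous_of_discreteTopology (f := fun b : Bool => xor b (a c))).comp (continuous_apply c)
  continuous_invFun := continuous_pi fun c =>
    (continuous_of_discreteTopology (f := fun b : Bool => xor b (a c))).comp (continuous_apply c)

theorem tendsto_translation {I : Type*} {u v : ℕ → I → Bool} {a : I → Bool}
    (h : ∀ c, ∀ᶠ m in atTop, v m c = xor (u m c) (a c)) (y : I → Bool) :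
    Tendsto v (atTop ⊓ comap u (𝓝 y)) (𝓝 (translation a y)) := by
  have ht : Tendsto (fun m => translation a (u m)) (atTop ⊓ comap u (𝓝 y))
      (𝓝 (translation a y)) :=
    ((translation a).continuous.tendsto y).comp (tendsto_comap.mono_left inf_le_right)
  rw [tendsto_pi_nhds] at ht ⊢
  refine fun c => (ht c).congr' ?_
  filter_upwards [(h c).filter_mono inf_le_left] with m hm
  exact hm.symm

/-- Martin's Axiom provides a permutation `σ` of `ℕ` such that `η ^ (σ m) (d) - η ^ m (d)`
converges to the difference of the second coordinates of the two points. -/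
theorem isHomogeneous_of_MA (hMA : MA) (hCH : ¬ CH) {d : Y}
    (hd : Dense (range fun n : ℕ => shift^[n] d)) : IsHomogeneous (X d) := by
  rintro ⟨x, y⟩ ⟨x', y'⟩
  let a : Y := fun c => xor (y c) (y' c)
  have hlt : Cardinal.mk ((Ordinal.omega.{0} 1).ToType × ℤ) < Cardinal.continuum := by
    rw [mk_index]
    exact Cardinal.aleph_one_le_continuum.lt_of_ne fun h => hCH h.symm
  have hpat : ∀ (F : Finset ((Ordinal.omega.{0} 1).ToType × ℤ)) (m n : ℕ),
      ∃ k ≥ n, ∀ c ∈ F, (shift^[k] d) c = xor ((shift^[m] d) c) (a c) := fun F m n =>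
    dense_tail hd (isOpen_pi_bool_eq (fun c => xor ((shift^[m] d) c) (a c)) F)
      ⟨_, fun _ _ => rfl⟩ n
  obtain ⟨σ, hσ⟩ := exists_perm_of_MA hMA hlt
    (fun c m k => (shift^[k] d) c = xor ((shift^[m] d) c) (a c)) hpat fun F k n => by
      obtain ⟨m, hm, h⟩ := hpat F k n
      exact ⟨m, hm, fun c hc => by rw [h c hc]; simp⟩
  have hσ' : ∀ c, ∀ᶠ m in atTop,
      (shift^[σ.symm m] d) c = xor ((shift^[m] d) c) (a c) := fun c => by
    have ht : Tendsto σ.symm atTop atTop := by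
      simpa [Nat.cofinite_eq_atTop] using σ.symm.injective.tendsto_cofinite
    filter_upwards [ht.eventually (hσ c)] with m hm
    rw [σ.apply_symm_apply] at hm
    rw [hm]
    simp
  obtain ⟨h, hh⟩ := exists_homeomorph_of_tendsto (η := shift) (d := d) (g := translation a)
    (σ := σ) (tendsto_translation hσ) (tendsto_translation hσ') x x' y
  refine ⟨h, hh.trans (Prod.ext rfl ?_)⟩
  funext c
  change xor (y c) (xor (y c) (y' c)) = y' c
  simp

theorem not_isHomogeneous_of_CH (hCH : CH) {d : Y}
    (hd : Dense (range fun n : ℕ => shift^[n] d)) : ¬ IsHomogeneous (X d) := by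
  intro hX
  obtain ⟨B, hBc, hB⟩ := exists_countable_piBase hd
  have := t2Space_resolution (η := shift) (d := d)
  have h1 : Cardinal.mk (X d) ≤ Cardinal.continuum := mk_le_of_isHomogeneous hX hBc hB
  have h2 : Cardinal.mk Y ≤ Cardinal.mk (X d) :=
    Cardinal.mk_le_of_injective (f := fun y => (pt (fun _ => false) y : X d))
      fun y y' h => congrArg Prod.snd h
  have h3 : Cardinal.mk Y = 2 ^ Cardinal.continuum := by
    rw [← Cardinal.power_def, Cardinal.mk_bool, mk_index, ← hCH]
  exact (Cardinal.cantor Cardinal.continuum).not_ge (h3 ▸ h2.trans h1)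

end VanMill

theorem mainTheorem1 :
    (∃ d : VanMill.Y, Dense (Set.range fun n : ℕ => VanMill.shift^[n] d)) ∧
    ∀ d : VanMill.Y, Dense (Set.range fun n : ℕ => VanMill.shift^[n] d) →
      CompactSpace (VanMill.X d) ∧ T2Space (VanMill.X d) ∧
      VanMill.IsZeroDimensional (VanMill.X d) ∧
      VanMill.piWeight (VanMill.X d) = Cardinal.aleph0 ∧
      VanMill.character (VanMill.X d) = Cardinal.aleph 1 ∧
      (VanMill.MA ∧ ¬ VanMill.CH → VanMill.IsHomogeneous (VanMill.X d)) ∧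
      (VanMill.CH → ¬ VanMill.IsHomogeneous (VanMill.X d)) := by

  refine ⟨VanMill.exists_dense_orbit, fun d hd => ⟨VanMill.compactSpace_resolution,
    VanMill.t2Space_resolution, VanMill.isZeroDimensional_resolution isTopologicalBasis_isClopen,
    VanMill.piWeight_resolution hd, VanMill.character_eq d,
    fun h => VanMill.isHomogeneous_of_MA h.1 h.2 hd,
    fun h => VanMill.not_isHomogeneous_of_CH h hd⟩⟩
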